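/- Let $\mathcal A$ be a unital $C^*$-algebra and let $H_{\mathcal A}$ be the standard (right) Hilbert $\mathcal A$-module, i.e. the set of all sequences $x=(x_i)_{i\in\mathbb N}$ in $\mathcal A$ for which $\sum_i x_i^*x_i$ converges in norm, with inner product $\langle x,y\rangle=\sum_i x_i^*y_i$ and norm $\|x\|=\|\langle x,x\rangle\|^{1/2}$. Let $B^a(H_{\mathcal A})$ be the algebra of bounded, $\mathcal A$-linear, adjointable operators on $H_{\mathcal A}$. A Hilbert submodule of $H_{\mathcal A}$ is a closed $\mathcal A$-submodule; a submodule is finitely generated if it is the $\mathcal A$-linear span of finitely many of its elements; $\cong$ means that there is a bounded $\mathcal A$-linear bijection with bounded inverse; $\oplus$ is the (external) direct sum; and $K^\perp=\{y:\langle x,y\rangle=0\ \text{for all}\ x\in K\}$. Let $\tilde{\mathcal M}\Phi_0^{gc}(H_{\mathcal A})$ be the class of all $T\in B^a(H_{\mathcal A})$ with closed range for which there exist finitely generated Hilbert submodules $N,\tilde N$ of $H_{\mathcal A}$ such that $$N\oplus\ker T\;\cong\;\tilde N\oplus(\operatorname{Im}T)^\perp .$$ Let $T\in\tilde{\mathcal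 M}\Phi_0^{gc}(H_{\mathcal A})$, and let $F\in B^a(H_{\mathcal A})$ be such that $\operatorname{Im}F$ is closed and finitely generated. Let $P$ denote the orthogonal projection of $H_{\mathcal A}$ onto $(\ker F)^\perp$ (which exists because $\operatorname{Im}F$ is closed). Suppose that $\operatorname{Im}(T+F)$, $T(\ker F)$, $P(\ker T)$ and $P(\ker(T+F))$ are closed in $H_{\mathcal A}$. Then $$T+F\in\tilde{\mathcal M}\Phi_0^{gc}(H_{\mathcal A}).$$ -/

import Mathlib

/-!
Hilbert C⋆-modules are right modules. A right `A`-module is a module over `Aᵐᵒᵖ`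
(`MulOpposite.op a • x` is `x · a`), and a right Hilbert `A`-module is a `CStarModule` over the
C⋆-algebra `Aᵐᵒᵖ`; its `A`-valued inner product is `MulOpposite.unop (inner Aᵐᵒᵖ x y)`, which is
`A`-linear in the second variable.
-/

section StandardModule

variable {A : Type*} [CStarAlgebra A] [PartialOrder A] [StarOrderedRing A]

/-- Comparison test for series of positive elements of a C⋆-algebra. -/
theorem summable_of_nonneg_of_le_cstar {a b : ℕ → A} (ha : ∀ i, 0 ≤ a i) (hab : ∀ i, a i ≤ b i)
    (hb : Summable b) : Summable a := by
  rw [summable_iff_vanishing_norm] at hb ⊢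
  intro ε hε
  obtain ⟨s, hs⟩ := hb ε hε
  refine ⟨s, fun t ht => lt_of_le_of_lt ?_ (hs t ht)⟩
  exact CStarAlgebra.norm_le_norm_of_nonneg_of_le (Finset.sum_nonneg fun i _ => ha i)
    (Finset.sum_le_sum fun i _ => hab i)

theorem summable_star_mul_self_add {x y : ℕ → A} (hx : Summable fun i => star (x i) * x i)
    (hy : Summable fun i => star (y i) * y i) :
    Summable fun i => star (x i + y i) * (x i + y i) := by
  refine summable_of_nonneg_of_le_cstar (fun i => star_mul_self_nonneg _) (fun i => ?_)
    ((hx.add hy).add (hx.add hy))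
  have h : 0 ≤ star (x i - y i) * (x i - y i) := star_mul_self_nonneg _
  rw [← sub_nonneg]
  convert h using 1
  simp only [star_add, star_sub]
  noncomm_ring

variable (A) in
/-- The square-summable sequences in `A`: those `x` for which the series `∑ x_i^* x_i` converges
in the norm of `A`. They form a right `A`-module. -/
def squareSummable : Submodule Aᵐᵒᵖ (ℕ → A) where
  carrier := {x | Summable fun i => star (x i) * x i}
  zero_mem' := by simp [summable_zero]
  add_mem' hx hy := summable_star_mul_self_add hx hy
  smul_mem' a x hx := by
    have h := (Summable.mul_left (star a.unop) hx).mul_right a.unop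
    simpa [mul_assoc] using h

variable (A) in
/-- The standard Hilbert module `H_A` over `A`. -/
def StandardModule : Type _ := squareSummable A

namespace StandardModule

noncomputable instance : AddCommGroup (StandardModule A) :=
  inferInstanceAs (AddCommGroup (squareSummable A))

noncomputable instance : Module Aᵐᵒᵖ (StandardModule A) :=
  inferInstanceAs (Module Aᵐᵒᵖ (squareSummable A))

noncomputable instance : Module ℂ (StandardModule A) :=
  inferInstanceAs (Module ℂ (squareSummable A))

/-- The `i`-th coordinate of an element of `H_A`. -/
def coord (x : StandardModule A) (i : ℕ) : A := x.1 i

@[ext]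
theorem ext {x y : StandardModule A} (h : ∀ i, x.coord i = y.coord i) : x = y :=
  Subtype.ext (funext h)

@[simp] theorem coord_zero (i : ℕ) : (0 : StandardModule A).coord i = 0 := rfl

@[simp] theorem coord_add (x y : StandardModule A) (i : ℕ) :
    (x + y).coord i = x.coord i + y.coord i := rfl

@[simp] theorem coord_smul (a : Aᵐᵒᵖ) (x : StandardModule A) (i : ℕ) :
    (a • x).coord i = x.coord i * a.unop := rfl

@[simp] theorem coord_smul_complex (z : ℂ) (x : StandardModule A) (i : ℕ) :
    (z • x).coord i = z • x.coord i := rfl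

theorem summable_self (x : StandardModule A) :
    Summable fun i => star (x.coord i) * x.coord i := x.2

theorem summable_inner (x y : StandardModule A) :
    Summable fun i => star (x.coord i) * y.coord i := by
  have h1 := ((x + y).summable_self.sub x.summable_self).sub y.summable_self
  have h2 := (((x + Complex.I • y).summable_self.sub x.summable_self).sub
    y.summable_self).const_smul (-Complex.I)
  have h3 := (h1.add h2).const_smul ((2 : ℂ)⁻¹)
  refine h3.congr fun i => ?_
  simp only [coord_add, coord_smul_complex, star_add, star_smul, mul_add, add_mul, smul_mul_assoc,
    mul_smul_comm, smul_add, smul_sub, smul_smul, Complex.star_def, Complex.conj_I]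
  match_scalars <;> ring_nf <;> norm_num [Complex.I_sq, Complex.I_pow_three]

noncomputable instance : Norm (StandardModule A) where
  norm x := √‖∑' i, star (x.coord i) * x.coord i‖

/-- The inner product `⟨x, y⟩ = ∑ x_i^* y_i` makes `H_A` a right Hilbert `A`-module. -/
noncomputable instance : CStarModule Aᵐᵒᵖ (StandardModule A) where
  inner x y := MulOpposite.op (∑' i, star (x.coord i) * y.coord i)
  inner_add_right {x y z} := by
    rw [← MulOpposite.op_add, ← (summable_inner x y).tsum_add (summable_inner x z)]
    simp [mul_add]
  inner_self_nonneg {x} := by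
    rw [MulOpposite.op_nonneg]
    exact tsum_nonneg fun i => star_mul_self_nonneg _
  inner_self {x} := by
    rw [MulOpposite.op_eq_zero_iff]
    refine ⟨fun h => ?_, fun h => by simp [h]⟩
    have h' := (hasSum_zero_iff_of_nonneg (fun i => star_mul_self_nonneg (x.coord i))).1
      (h ▸ x.summable_self.hasSum)
    ext i
    simpa using congrFun h' i
  inner_op_smul_right {a x y} := by
    have h := (summable_inner x y).tsum_mul_right a.unop
    apply MulOpposite.unop_injective
    simpa [mul_assoc] using h
  inner_smul_right_complex {z x y} := by
    rw [← MulOpposite.op_smul, ← (summable_inner x y).tsum_const_smul]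
    simp
  star_inner x y := by
    rw [← MulOpposite.op_star, tsum_star]
    simp
  norm_eq_sqrt_norm_inner_self x := by
    rw [MulOpposite.norm_op]
    rfl

noncomputable instance : NormedAddCommGroup (StandardModule A) :=
  CStarModule.normedAddCommGroup Aᵐᵒᵖ

noncomputable instance : NormedSpace ℂ (StandardModule A) :=
  NormedSpace.ofCore (CStarModule.normedSpaceCore Aᵐᵒᵖ)

end StandardModule

end StandardModule

section Operators

variable {B : Type*} [CStarAlgebra B] [PartialOrder B]
variable {E E' : Type*} [NormedAddCommGroup E] [NormedSpace ℂ E] [Module B E] [CStarModule B E]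
  [NormedAddCommGroup E'] [NormedSpace ℂ E'] [Module B E'] [CStarModule B E']

/-- The orthogonal complement of a submodule of a Hilbert C⋆-module. -/
def orthCompl (K : Submodule B E) : Submodule B E where
  carrier := {y | ∀ x ∈ K, inner B x y = 0}
  zero_mem' := fun x _ => by simp
  add_mem' := fun hy hz x hx => by simp [hy x hx, hz x hx]
  smul_mem' := fun b y hy x hx => by simp [hy x hx]

/-- A bounded module map is adjointable if it has an adjoint with respect to the inner products. -/
def IsAdjointable (T : E →L[B] E') : Prop :=
  ∃ S : E' →L[B] E, ∀ x y, inner B (T x) y = inner B x (S y)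

/-- A component of `x` along `K` with remainder orthogonal to `K` is unique. -/
theorem eq_of_sub_mem_orthCompl {K : Submodule B E} {x y z : E} (hy : y ∈ K)
    (hxy : x - y ∈ orthCompl K) (hz : z ∈ K) (hxz : x - z ∈ orthCompl K) : y = z := by
  have h1 : y - z ∈ K := K.sub_mem hy hz
  have h2 : y - z ∈ orthCompl K := by
    have := (orthCompl K).sub_mem hxz hxy
    rwa [sub_sub_sub_cancel_left] at this
  exact sub_eq_zero.1 ((CStarModule.inner_self (A := B)).1 (h2 _ h1))

open Classical in
/-- The orthogonal projection onto `K`: the point `y ∈ K` with `x - y ⟂ K`. It is defined on the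
whole of `E` when `K` is orthogonally complementable (and is set to `0` where there is no such
point). -/
noncomputable def orthProj (K : Submodule B E) (x : E) : E :=
  if h : ∃ y ∈ K, x - y ∈ orthCompl K then h.choose else 0

theorem orthProj_eq {K : Submodule B E} {x y : E} (hy : y ∈ K) (hxy : x - y ∈ orthCompl K) :
    orthProj K x = y := by
  have h : ∃ y ∈ K, x - y ∈ orthCompl K := ⟨y, hy, hxy⟩
  rw [orthProj, dif_pos h]
  exact eq_of_sub_mem_orthCompl h.choose_spec.1 h.choose_spec.2 hy hxy

end Operators

/-- The class `M̃Φ₀^{gc}(H_A)`: adjointable operators `T` on `H_A` with closed range such that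
`N ⊕ ker T ≅ N' ⊕ (Im T)^⊥` for some finitely generated Hilbert (i.e. closed) submodules `N`, `N'`.
The sums are external; `≅` is a bounded `A`-linear bijection with bounded inverse, for which only
the topology of the direct sum matters, and this is the product topology. -/
def IsGenWeylStable {A : Type*} [CStarAlgebra A] [PartialOrder A] [StarOrderedRing A]
    (T : StandardModule A →L[Aᵐᵒᵖ] StandardModule A) : Prop :=
  IsAdjointable T ∧ IsClosed (T.range : Set (StandardModule A)) ∧
    ∃ N N' : Submodule Aᵐᵒᵖ (StandardModule A),
      N.FG ∧ IsClosed (N : Set (StandardModule A)) ∧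
      N'.FG ∧ IsClosed (N' : Set (StandardModule A)) ∧
      Nonempty ((N × T.ker) ≃L[Aᵐᵒᵖ] (N' × orthCompl T.range))

/-! Write `K = ker F` and `P` for the projection onto `K^⊥`. The operators `T` and `T + F` agree on
`K`, so they share `Z = ker T ∩ K` and the image `T(K)`; everything else is controlled by `K^⊥ =
F*(Im F)`, which is finitely generated. Kernels: `P` restricted to `ker T` has kernel `Z`, whence
`ker T ≅ Z ⊕ L` with `L = P(ker T)`. Being closed, `L` is the range of an adjointable operator,
hence complemented, hence a projected image of `K^⊥`, hence finitely generated
(`exists_ker_equiv_inf_ker_prod`). Cokernels: `W = T(K)^⊥` splits as `(Im T)^⊥ ⊕ R` with `R = W ∩ Im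
T`, again an image of `K^⊥` (`exists_orthCompl_map_ker_equiv_orthCompl_range_prod`). The same holds
for `T + F`, with the same `Z` and `W` and new pieces `L'`, `R'`. Substituting into `N ⊕ ker T ≅ N'
⊕ (Im T)^⊥` gives `(N ⊕ L ⊕ R) ⊕ ker(T+F) ≅ (N' ⊕ L' ⊕ R') ⊕ Im(T+F)^⊥`, and the bracketed sums
embed in `H_A` as finitely generated closed submodules. The analytic input is that kernel and range
of an adjointable operator with closed range are complemented; it rests on the invertibility of `T
T*` on `Im T`. -/

/-! ### Invertibility by continuation along the imaginary axis. -/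

section Perturbation

variable {X : Type*} [NormedAddCommGroup X] [NormedSpace ℂ X] [CompleteSpace X]

/-- An operator close to an invertible operator, relative to the lower bound of the latter, is
invertible. -/
theorem isUnit_of_norm_sub_lt {R R' : X →L[ℂ] X} {c : ℝ} (hR : IsUnit R)
    (hc : ∀ y, c * ‖y‖ ≤ ‖R y‖) (h : ‖R' - R‖ < c) : IsUnit R' := by
  obtain ⟨u, rfl⟩ := hR
  have hc0 : 0 < c := (norm_nonneg _).trans_lt h
  have hinv : ‖(↑u⁻¹ : X →L[ℂ] X)‖ ≤ c⁻¹ := by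
    refine ContinuousLinearMap.opNorm_le_bound _ (inv_nonneg.2 hc0.le) fun y => ?_
    have h1 := hc ((↑u⁻¹ : X →L[ℂ] X) y)
    have h2 : (u : X →L[ℂ] X) ((↑u⁻¹ : X →L[ℂ] X) y) = y := by
      rw [← mul_apply_eq_comp, u.mul_inv]; rfl
    rw [h2] at h1
    rwa [inv_mul_eq_div, le_div_iff₀' hc0]
  have hlt : ‖(↑u⁻¹ : X →L[ℂ] X) * (u - R')‖ < 1 := by
    calc ‖(↑u⁻¹ : X →L[ℂ] X) * (u - R')‖ ≤ ‖(↑u⁻¹ : X →L[ℂ] X)‖ * ‖u - R'‖ := norm_mul_le _ _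
      _ ≤ c⁻¹ * ‖u - R'‖ := by gcongr
      _ < c⁻¹ * c := by
        rw [norm_sub_rev]
        exact mul_lt_mul_of_pos_left h (inv_pos.2 hc0)
      _ = 1 := inv_mul_cancel₀ hc0.ne'
  -- The second factor is inverted by a Neumann series.
  have hfac : R' = u * (1 - (↑u⁻¹ : X →L[ℂ] X) * (u - R')) := by
    rw [mul_sub, ← mul_assoc, u.mul_inv]; simp
  rw [hfac]
  exact u.isUnit.mul (isUnit_one_sub_of_norm_lt_one hlt)

/-- An operator that is bounded below, and whose translates by imaginary scalars satisfy the lower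
bounds of a self-adjoint operator, is invertible. -/
theorem isUnit_of_forall_le_norm_sub_smul {G : X →L[ℂ] X} {δ : ℝ} (hδ : 0 < δ)
    (h : ∀ (t : ℝ) y, δ * ‖y‖ ≤ ‖(G - (t * Complex.I) • (1 : X →L[ℂ] X)) y‖)
    (h' : ∀ (t : ℝ) y, |t| * ‖y‖ ≤ ‖(G - (t * Complex.I) • (1 : X →L[ℂ] X)) y‖) :
    IsUnit G := by
  have hone : ‖(1 : X →L[ℂ] X)‖ ≤ 1 := ContinuousLinearMap.norm_id_le
  have hnorm : ∀ s : ℝ, ‖((s : ℂ) * Complex.I) • (1 : X →L[ℂ] X)‖ ≤ |s| := fun s => by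
    rw [norm_smul]
    simpa using mul_le_of_le_one_right (abs_nonneg s) hone
  set r : ℝ := ‖G‖ + 1 with hr
  have hr0 : 0 < r := by positivity
  -- Start at `ir`, where `r > ‖G‖`, and halve: the step from `r/2^n` has length `r/2^(n+1)`, less
  -- than the lower bound `r/2^n` at its starting point. Halving never reaches `0`; the uniform
  -- bound `δ` covers the last step.
  have key : ∀ n : ℕ, IsUnit (G - (((r / 2 ^ n : ℝ) : ℂ) * Complex.I) • (1 : X →L[ℂ] X)) := by
    intro n
    induction n with
    | zero =>
      have hu : IsUnit ((-((r : ℂ) * Complex.I)) • (1 : X →L[ℂ] X)) := by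
        have hne : -((r : ℂ) * Complex.I) ≠ 0 := by
          simp [hr0.ne', Complex.I_ne_zero]
        exact (Units.mk0 _ hne • (1 : (X →L[ℂ] X)ˣ)).isUnit
      refine isUnit_of_norm_sub_lt (c := r) hu (fun y => ?_) ?_
      · simp [norm_smul, abs_of_pos hr0]
      · have : G - (((r / 2 ^ 0 : ℝ) : ℂ) * Complex.I) • (1 : X →L[ℂ] X)
            - (-((r : ℂ) * Complex.I)) • (1 : X →L[ℂ] X) = G := by
          simp
        rw [this]
        linarith
    | succ n ih =>
      have hpos : 0 < r / 2 ^ n := by positivity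
      refine isUnit_of_norm_sub_lt (c := |r / 2 ^ n|) ih (h' _) ?_
      have : G - (((r / 2 ^ (n + 1) : ℝ) : ℂ) * Complex.I) • (1 : X →L[ℂ] X)
          - (G - (((r / 2 ^ n : ℝ) : ℂ) * Complex.I) • (1 : X →L[ℂ] X))
          = (((r / 2 ^ (n + 1) : ℝ) : ℂ) * Complex.I) • (1 : X →L[ℂ] X) := by
        rw [sub_sub_sub_cancel_left, ← sub_smul, ← sub_mul, ← Complex.ofReal_sub]
        congr 4
        rw [pow_succ]
        field_simp
        norm_num
      rw [this]
      refine (hnorm _).trans_lt ?_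
      rw [abs_of_pos hpos, abs_of_pos (by positivity), pow_succ, ← div_div]
      exact half_lt_self hpos
  obtain ⟨n, hn⟩ := exists_pow_lt_of_lt_one (div_pos hδ hr0) (one_half_lt_one (α := ℝ))
  refine isUnit_of_norm_sub_lt (key n) (h _) ?_
  rw [sub_sub_cancel]
  refine (hnorm _).trans_lt ?_
  rw [abs_of_pos (by positivity)]
  rw [lt_div_iff₀ hr0, one_div, inv_pow] at hn
  rwa [div_eq_inv_mul]

end Perturbation

/-! ### Orthogonal complements and projections in Hilbert modules. -/

section OrthogonalComplement

variable {B : Type*} [CStarAlgebra B] [PartialOrder B]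
variable {E E' : Type*} [NormedAddCommGroup E] [NormedSpace ℂ E] [Module B E] [CStarModule B E]
  [NormedAddCommGroup E'] [NormedSpace ℂ E'] [Module B E'] [CStarModule B E']

theorem inner_eq_zero_comm {x y : E} : inner B x y = 0 ↔ inner B y x = 0 := by
  rw [← CStarModule.star_inner y x, star_eq_zero]

/-- The cross terms cancel because `ti` is conjugated to `-ti` in the first slot. As a sum of
positive elements dominates each summand, this supplies both lower bounds needed by
`isUnit_of_forall_le_norm_sub_smul`. -/
theorem inner_sub_imaginary_smul_self {x y : E} (h : inner B x y = inner B y x) (t : ℝ) :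
    inner B (x - (t * Complex.I) • y) (x - (t * Complex.I) • y)
      = inner B x x + inner B (t • y) (t • y) := by
  simp only [CStarModule.inner_sub_left, CStarModule.inner_sub_right,
    CStarModule.inner_smul_left_complex, CStarModule.inner_smul_right_complex,
    CStarModule.inner_smul_left_real, CStarModule.inner_smul_right_real, h, smul_smul]
  have : t • t • inner B y y = ((t : ℂ) * t) • inner B y y := by
    rw [← smul_smul, Complex.coe_smul, Complex.coe_smul]
  rw [smul_smul] at this
  rw [this]
  match_scalars <;> simp
  ring_nf
  simp

theorem orthCompl_anti {K L : Submodule B E} (h : K ≤ L) : orthCompl L ≤ orthCompl K :=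
  fun _ hx y hy => hx y (h hy)

/-- `K` is orthogonally complementable: every vector is the sum of a vector in `K` and one
orthogonal to `K`. -/
def IsOrthComplemented (K : Submodule B E) : Prop :=
  ∀ x, ∃ y ∈ K, x - y ∈ orthCompl K

namespace IsOrthComplemented

variable {K : Submodule B E} (hK : IsOrthComplemented K)

include hK in
theorem orthProj_mem (x : E) : orthProj K x ∈ K := by
  obtain ⟨y, hy, hxy⟩ := hK x
  rwa [orthProj_eq hy hxy]

include hK in
theorem sub_orthProj_mem (x : E) : x - orthProj K x ∈ orthCompl K := by
  obtain ⟨y, hy, hxy⟩ := hK x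
  rwa [orthProj_eq hy hxy]

end IsOrthComplemented

variable [StarOrderedRing B]

variable (B) in
theorem norm_le_norm_of_inner_self_le {x : E} {y : E'} (h : inner B x x ≤ inner B y y) :
    ‖x‖ ≤ ‖y‖ := by
  rw [CStarModule.norm_eq_sqrt_norm_inner_self (A := B) x,
    CStarModule.norm_eq_sqrt_norm_inner_self (A := B) y]
  exact Real.sqrt_le_sqrt
    (CStarAlgebra.norm_le_norm_of_nonneg_of_le CStarModule.inner_self_nonneg h)

theorem norm_le_norm_add_of_inner_eq_zero {x y : E} (h : inner B x y = 0) : ‖x‖ ≤ ‖x + y‖ := by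
  refine norm_le_norm_of_inner_self_le B ?_
  have h' : inner B y x = 0 := inner_eq_zero_comm.1 h
  simp only [CStarModule.inner_add_left, CStarModule.inner_add_right, h, h', zero_add, add_zero]
  exact le_add_of_nonneg_right CStarModule.inner_self_nonneg

theorem isClosed_orthCompl (K : Submodule B E) : IsClosed (orthCompl K : Set E) := by
  have : (orthCompl K : Set E) = ⋂ x ∈ K, {y | inner B x y = 0} := by
    ext y
    simp [orthCompl]
  rw [this]
  refine isClosed_biInter fun x _ => isClosed_eq ?_ continuous_const
  exact CStarModule.continuous_inner.comp (continuous_const.prodMk continuous_id)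

namespace IsOrthComplemented

variable {K : Submodule B E} (hK : IsOrthComplemented K)

/-- The orthogonal projection onto an orthogonally complementable submodule, as a bounded
operator. -/
noncomputable def proj : E →L[B] E where
  toFun := orthProj K
  map_add' x y := orthProj_eq (K.add_mem (hK.orthProj_mem x) (hK.orthProj_mem y)) (by
    rw [add_sub_add_comm]
    exact (orthCompl K).add_mem (hK.sub_orthProj_mem x) (hK.sub_orthProj_mem y))
  map_smul' b x := orthProj_eq (K.smul_mem b (hK.orthProj_mem x)) (by
    rw [RingHom.id_apply, ← smul_sub]
    exact (orthCompl K).smul_mem b (hK.sub_orthProj_mem x))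
  cont := by
    have hadd : ∀ x y, orthProj K (x - y) = orthProj K x - orthProj K y := fun x y =>
      orthProj_eq (K.sub_mem (hK.orthProj_mem x) (hK.orthProj_mem y)) (by
        rw [sub_sub_sub_comm]
        exact (orthCompl K).sub_mem (hK.sub_orthProj_mem x) (hK.sub_orthProj_mem y))
    refine (LipschitzWith.of_dist_le_mul (K := 1) fun x y => ?_).continuous
    rw [dist_eq_norm, dist_eq_norm, ← hadd, NNReal.coe_one, one_mul]
    have := norm_le_norm_add_of_inner_eq_zero
      (hK.sub_orthProj_mem (x - y) _ (hK.orthProj_mem (x - y)))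
    rwa [add_sub_cancel] at this

theorem proj_mem (x : E) : hK.proj x ∈ K := hK.orthProj_mem x

theorem sub_proj_mem (x : E) : x - hK.proj x ∈ orthCompl K := hK.sub_orthProj_mem x

theorem proj_eq_self {x : E} (hx : x ∈ K) : hK.proj x = x :=
  orthProj_eq hx (by simp)

theorem proj_eq_zero {x : E} (hx : x ∈ orthCompl K) : hK.proj x = 0 :=
  orthProj_eq K.zero_mem (by simpa using hx)

theorem range_proj : hK.proj.range = K := by
  ext x
  exact ⟨fun ⟨y, hy⟩ => hy ▸ hK.proj_mem y, fun hx => ⟨x, hK.proj_eq_self hx⟩⟩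

theorem inner_proj_left (x y : E) : inner B (hK.proj x) y = inner B x (hK.proj y) := by
  have h1 := hK.sub_proj_mem y _ (hK.proj_mem x)
  have h2 := inner_eq_zero_comm.1 (hK.sub_proj_mem x _ (hK.proj_mem y))
  rw [CStarModule.inner_sub_right, sub_eq_zero] at h1
  rw [CStarModule.inner_sub_left, sub_eq_zero] at h2
  rw [h1, h2]

theorem isAdjointable_proj : IsAdjointable hK.proj := ⟨hK.proj, hK.inner_proj_left⟩

-- For `x` in the double complement, the remainder `x - hK.proj x` lies in both `K^⊥` and `K^⊥⊥`, so
-- it is orthogonal to itself.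
include hK in
theorem orthCompl_orthCompl : orthCompl (orthCompl K) = K := by
  ext x
  refine ⟨fun hx => ?_, fun hx y hy => inner_eq_zero_comm.1 (hy x hx)⟩
  have h1 : x - hK.proj x ∈ orthCompl (orthCompl K) :=
    Submodule.sub_mem _ hx fun y hy => inner_eq_zero_comm.1 (hy _ (hK.proj_mem x))
  have h2 := (CStarModule.inner_self (A := B)).1 (h1 _ (hK.sub_proj_mem x))
  rw [sub_eq_zero.1 h2]
  exact hK.proj_mem x

include hK in
theorem orthCompl : IsOrthComplemented (orthCompl K) := fun x =>
  ⟨x - hK.proj x, hK.sub_proj_mem x, fun y hy => by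
    rw [sub_sub_cancel]
    exact inner_eq_zero_comm.1 (hy _ (hK.proj_mem x))⟩

end IsOrthComplemented

end OrthogonalComplement

/-! ### Adjointable operators with closed range. -/

section ClosedRange

variable {B : Type*} [CStarAlgebra B] [PartialOrder B]
variable {E : Type*} [NormedAddCommGroup E] [NormedSpace ℂ E] [Module B E] [CStarModule B E]

theorem IsAdjointable.comp {T S : E →L[B] E} (hT : IsAdjointable T) (hS : IsAdjointable S) :
    IsAdjointable (T.comp S) := by
  obtain ⟨T', hT'⟩ := hT
  obtain ⟨S', hS'⟩ := hS
  exact ⟨S'.comp T', fun x y => by simp [hT', hS']⟩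

theorem IsAdjointable.add {T S : E →L[B] E} (hT : IsAdjointable T) (hS : IsAdjointable S) :
    IsAdjointable (T + S) := by
  obtain ⟨T', hT'⟩ := hT
  obtain ⟨S', hS'⟩ := hS
  exact ⟨T' + S', fun x y => by simp [hT', hS']⟩

theorem orthCompl_range_eq_ker {T S : E →L[B] E}
    (hTS : ∀ x y, inner B (T x) y = inner B x (S y)) : orthCompl T.range = S.ker := by
  ext y
  constructor
  · intro hy
    refine (CStarModule.inner_self (A := B)).1 ?_
    rw [ContinuousLinearMap.coe_coe, ← hTS]
    exact hy _ ⟨_, rfl⟩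
  · rintro hy _ ⟨x, rfl⟩
    have hy : S y = 0 := hy
    rw [ContinuousLinearMap.coe_coe, hTS, hy, CStarModule.inner_zero_right]

theorem adjoint_mem_orthCompl_ker {T S : E →L[B] E}
    (hTS : ∀ x y, inner B (T x) y = inner B x (S y)) (y : E) : S y ∈ orthCompl T.ker := by
  intro x hx
  have hx : T x = 0 := hx
  rw [← hTS, hx, CStarModule.inner_zero_left]

variable [StarOrderedRing B] [IsScalarTower ℂ B E] [CompleteSpace E]

/-- An adjointable operator with closed range maps the range of its adjoint onto its own range. -/
theorem exists_apply_apply_adjoint_eq {T S : E →L[B] E}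
    (hTS : ∀ x y, inner B (T x) y = inner B x (S y)) (hT : IsClosed (T.range : Set E)) (x : E) :
    ∃ y ∈ T.range, T (S y) = T x := by
  have : CompleteSpace T.range := hT.completeSpace_coe
  let T₀ : E →L[ℂ] T.range :=
    ⟨(T.toLinearMap.rangeRestrict).restrictScalars ℂ, by
      exact T.continuous.subtype_mk _⟩
  have hT₀ : ∀ x, (T₀ x : E) = T x := fun _ => rfl
  have hsurj : Function.Surjective T₀ := T.toLinearMap.surjective_rangeRestrict
  let ι : T.range →L[ℂ] E := ⟨T.range.subtype.restrictScalars ℂ, continuous_subtype_val⟩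
  let S₀ : E →L[ℂ] E := S.restrictScalars ℂ
  let G : T.range →L[ℂ] T.range := T₀.comp (S₀.comp ι)
  have hG : ∀ y, (G y : E) = T (S y) := fun _ => rfl
  obtain ⟨C, hC, hpre⟩ := T₀.exists_preimage_norm_le hsurj
  -- The open mapping theorem gives `y = T z` with `‖z‖ ≤ C‖y‖`; then `⟨y, y⟩ = ⟨z, S y⟩` and
  -- Cauchy–Schwarz bound `S` below on `Im T`.
  have hS_below : ∀ y : T.range, ‖y‖ ≤ C * ‖S y‖ := by
    intro y
    obtain ⟨z, hz, hzC⟩ := hpre y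
    have hz' : T z = y := by rw [← hz, hT₀]
    have h1 : ‖(y : E)‖ ^ 2 ≤ C * ‖y‖ * ‖S y‖ := by
      rw [CStarModule.norm_sq_eq B]
      nth_rw 1 [← hz']
      rw [hTS]
      exact (CStarModule.norm_inner_le E).trans (by gcongr)
    have h2 : ‖y‖ ^ 2 ≤ C * ‖y‖ * ‖S y‖ := h1
    rcases (norm_nonneg y).eq_or_lt with h0 | h0
    · rw [← h0]; positivity
    · nlinarith
  -- Here `⟨S y, S y⟩ = ⟨G y, y⟩`, so the lower bound for `S` passes to `G = T S` with its constant
  -- squared.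
  have hG_below : ∀ y : T.range, ‖y‖ ≤ C ^ 2 * ‖G y‖ := by
    intro y
    have h1 : ‖S y‖ ^ 2 ≤ ‖G y‖ * ‖y‖ := by
      rw [CStarModule.norm_sq_eq B, ← hTS]
      exact CStarModule.norm_inner_le E
    have h2 : ‖y‖ ^ 2 ≤ C ^ 2 * (‖G y‖ * ‖y‖) := by
      calc ‖y‖ ^ 2 ≤ (C * ‖S y‖) ^ 2 := by gcongr; exact hS_below y
        _ = C ^ 2 * ‖S y‖ ^ 2 := by ring
        _ ≤ _ := by gcongr
    rcases (norm_nonneg y).eq_or_lt with h0 | h0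
    · rw [← h0]; positivity
    · nlinarith
  have hsymm : ∀ y : T.range, inner B (G y : E) (y : E) = inner B (y : E) (G y : E) := by
    intro y
    rw [hG, hTS, ← CStarModule.star_inner (S y) (S y), ← hTS, CStarModule.star_inner]
  have hexp : ∀ (t : ℝ) (y : T.range),
      inner B ((G - (t * Complex.I) • (1 : T.range →L[ℂ] T.range)) y : E)
        ((G - (t * Complex.I) • (1 : T.range →L[ℂ] T.range)) y : E)
      = inner B (G y : E) (G y : E) + inner B (t • (y : E)) (t • (y : E)) := fun t y =>
    inner_sub_imaginary_smul_self (hsymm y) t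
  have hunit : IsUnit G := by
    refine isUnit_of_forall_le_norm_sub_smul (δ := (C ^ 2)⁻¹) (by positivity) (fun t y => ?_)
      fun t y => ?_
    · have h1 : ‖(G y : E)‖ ≤ ‖((G - (t * Complex.I) • (1 : T.range →L[ℂ] T.range)) y : E)‖ := by
        refine norm_le_norm_of_inner_self_le B ?_
        rw [hexp]
        exact le_add_of_nonneg_right CStarModule.inner_self_nonneg
      refine le_trans ?_ h1
      rw [inv_mul_le_iff₀ (by positivity)]
      exact hG_below y
    · have h1 : ‖t • (y : E)‖ ≤
          ‖((G - (t * Complex.I) • (1 : T.range →L[ℂ] T.range)) y : E)‖ := by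
        refine norm_le_norm_of_inner_self_le B ?_
        rw [hexp]
        exact le_add_of_nonneg_left CStarModule.inner_self_nonneg
      rwa [norm_smul] at h1
  obtain ⟨u, hu⟩ := hunit
  refine ⟨(↑u⁻¹ : T.range →L[ℂ] T.range) (T₀ x), Subtype.coe_prop _, ?_⟩
  rw [← hG, ← hu, ← mul_apply_eq_comp, u.mul_inv]
  rfl

/-- If `y ∈ Im T` solves `T S y = T S x`, then `⟨S(x - y), S(x - y)⟩ = ⟨T S(x - y), x - y⟩ = 0`, so
`x - y ∈ ker S = (Im T)^⊥`. -/
theorem isOrthComplemented_range {T : E →L[B] E} (hT : IsAdjointable T)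
    (hcl : IsClosed (T.range : Set E)) : IsOrthComplemented T.range := by
  obtain ⟨S, hTS⟩ := hT
  intro x
  obtain ⟨y, hy, hxy⟩ : ∃ y ∈ T.range, T (S y) = T (S x) :=
    exists_apply_apply_adjoint_eq hTS hcl (S x)
  refine ⟨y, hy, ?_⟩
  rw [orthCompl_range_eq_ker hTS]
  refine (CStarModule.inner_self (A := B)).1 ?_
  rw [ContinuousLinearMap.coe_coe, ← hTS, map_sub, map_sub, hxy, sub_self,
    CStarModule.inner_zero_left]

theorem exists_sub_adjoint_mem_ker {T S : E →L[B] E}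
    (hTS : ∀ x y, inner B (T x) y = inner B x (S y)) (hcl : IsClosed (T.range : Set E)) (x : E) :
    ∃ y ∈ T.range, x - S y ∈ T.ker := by
  obtain ⟨y, hy, hxy⟩ := exists_apply_apply_adjoint_eq hTS hcl x
  refine ⟨y, hy, ?_⟩
  rw [LinearMap.mem_ker, ContinuousLinearMap.coe_coe, map_sub, hxy, sub_self]

theorem isOrthComplemented_ker {T : E →L[B] E} (hT : IsAdjointable T)
    (hcl : IsClosed (T.range : Set E)) : IsOrthComplemented T.ker := by
  obtain ⟨S, hTS⟩ := hT
  intro x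
  obtain ⟨y, -, hy⟩ := exists_sub_adjoint_mem_ker hTS hcl x
  exact ⟨x - S y, hy, by rw [sub_sub_cancel]; exact adjoint_mem_orthCompl_ker hTS y⟩

/-- The orthogonal complement of the kernel is the image of the range under the adjoint. -/
theorem orthCompl_ker_eq_map_adjoint {T S : E →L[B] E}
    (hTS : ∀ x y, inner B (T x) y = inner B x (S y)) (hcl : IsClosed (T.range : Set E)) :
    orthCompl T.ker = T.range.map S.toLinearMap := by
  ext x
  constructor
  · intro hx
    obtain ⟨y, hy, hxy⟩ := exists_sub_adjoint_mem_ker hTS hcl x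
    have h := (orthCompl T.ker).sub_mem hx (adjoint_mem_orthCompl_ker hTS y) _ hxy
    exact ⟨y, hy, (sub_eq_zero.1 ((CStarModule.inner_self (A := B)).1 h)).symm⟩
  · rintro ⟨y, -, rfl⟩
    exact adjoint_mem_orthCompl_ker hTS y

end ClosedRange

/-! ### Splitting a closed submodule along a bounded module map. -/

section Splitting

variable {B : Type*} [Ring B] [Module ℂ B]

/-- A bounded bijective module map between Banach modules has a bounded inverse. -/
theorem nonempty_continuousLinearEquiv_of_bijective {X Y : Type*} [NormedAddCommGroup X]
    [NormedSpace ℂ X] [Module B X] [IsScalarTower ℂ B X] [CompleteSpace X] [NormedAddCommGroup Y]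
    [NormedSpace ℂ Y] [Module B Y] [IsScalarTower ℂ B Y] [CompleteSpace Y] (f : X →L[B] Y)
    (hf : Function.Bijective f) : Nonempty (X ≃L[B] Y) :=
  ⟨{ LinearEquiv.ofBijective f.toLinearMap hf with
      continuous_toFun := f.continuous
      continuous_invFun := (Equiv.continuous_symm_iff
        (LinearEquiv.ofBijective f.toLinearMap hf).toEquiv).2
        ((f.restrictScalars ℂ).isOpenMap hf.2) }⟩

variable {E E' : Type*} [NormedAddCommGroup E] [NormedSpace ℂ E] [Module B E]
  [IsScalarTower ℂ B E] [CompleteSpace E] [NormedAddCommGroup E'] [NormedSpace ℂ E'] [Module B E']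
  [IsScalarTower ℂ B E'] [CompleteSpace E']

/-- A closed submodule `M` splits as `(M ⊓ ker f) × f(M)` if `f(M)` is closed and there is a bounded
projection of `M` onto `M ⊓ ker f`. -/
theorem nonempty_equiv_inf_ker_prod_map {M : Submodule B E} (hM : IsClosed (M : Set E))
    (f : E →L[B] E') (hf : IsClosed (M.map f.toLinearMap : Set E')) (p : E →L[B] E)
    (hp : ∀ x ∈ M, p x ∈ M ⊓ f.ker) (hp' : ∀ x ∈ M ⊓ f.ker, p x = x) :
    Nonempty (M ≃L[B] ((M ⊓ f.ker : Submodule B E) × M.map f.toLinearMap)) := by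
  have : CompleteSpace M := hM.completeSpace_coe
  have : CompleteSpace (M.map f.toLinearMap) := hf.completeSpace_coe
  have hMf : IsClosed ((M ⊓ f.ker : Submodule B E) : Set E) := hM.inter f.isClosed_ker
  have : CompleteSpace (M ⊓ f.ker : Submodule B E) := hMf.completeSpace_coe
  let Φ : M →L[B] ((M ⊓ f.ker : Submodule B E) × M.map f.toLinearMap) :=
    ((p.comp M.subtypeL).codRestrict _ fun x => hp x x.2).prod
      ((f.comp M.subtypeL).codRestrict _ fun x => ⟨x, x.2, rfl⟩)
  have hΦ₁ : ∀ x, ((Φ x).1 : E) = p x := fun _ => rfl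
  have hΦ₂ : ∀ x, ((Φ x).2 : E') = f x := fun _ => rfl
  refine nonempty_continuousLinearEquiv_of_bijective Φ ⟨?_, ?_⟩
  · refine (injective_iff_map_eq_zero Φ).2 fun x hx => ?_
    have h₁ : p x = 0 := by rw [← hΦ₁, hx]; rfl
    have h₂ : f x = 0 := by rw [← hΦ₂, hx]; rfl
    exact Subtype.ext ((hp' x ⟨x.2, h₂⟩).symm.trans h₁)
  · rintro ⟨z, ⟨_, u, hu, rfl⟩⟩
    have hfz : f z = 0 := z.2.2
    have hfp : f (p u) = 0 := (hp u hu).2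
    -- Subtracting `p u` leaves `f u` unchanged and makes the component in the kernel vanish, so `z`
    -- can then be added freely.
    refine ⟨⟨z + (u - p u), M.add_mem z.2.1 (M.sub_mem hu (hp u hu).1)⟩, Prod.ext ?_ ?_⟩
    · refine Subtype.ext ?_
      rw [hΦ₁]
      simp [hp' z z.2, hp' (p u) (hp u hu)]
    · refine Subtype.ext ?_
      rw [hΦ₂]
      simp [hfz, hfp]

end Splitting

/-! ### Realising direct sums inside a module that contains two orthogonal copies of itself. -/

section Embedding

variable {B : Type*} [CStarAlgebra B] [PartialOrder B] [StarOrderedRing B]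
variable {E : Type*} [NormedAddCommGroup E] [NormedSpace ℂ E] [Module B E] [CStarModule B E]
  [IsScalarTower ℂ B E] [CompleteSpace E]

/-- If `E` contains two orthogonal isometric copies of itself, then a direct sum of two finitely
generated closed submodules of `E` is isomorphic to a finitely generated closed submodule. -/
theorem exists_fg_isClosed_equiv_prod {e₁ e₂ : E →L[B] E} (h₁ : ∀ x, ‖e₁ x‖ = ‖x‖)
    (h₂ : ∀ x, ‖e₂ x‖ = ‖x‖) (h : ∀ x y, inner B (e₁ x) (e₂ y) = 0) {M N : Submodule B E}
    (hM : M.FG) (hM' : IsClosed (M : Set E)) (hN : N.FG) (hN' : IsClosed (N : Set E)) :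
    ∃ L : Submodule B E, L.FG ∧ IsClosed (L : Set E) ∧ Nonempty (L ≃L[B] (M × N)) := by
  have : CompleteSpace M := hM'.completeSpace_coe
  have : CompleteSpace N := hN'.completeSpace_coe
  let g : M × N →L[B] E := (e₁.comp M.subtypeL).coprod (e₂.comp N.subtypeL)
  have hg : ∀ z, g z = e₁ z.1 + e₂ z.2 := fun _ => rfl
  -- The product carries the maximum norm, and each summand of `g z` is dominated by the orthogonal
  -- sum. Hence `g` is injective with closed range.
  have hbound : ∀ z, ‖z‖ ≤ ‖g z‖ := by
    rintro ⟨x, y⟩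
    refine max_le ?_ ?_
    · change ‖(x : E)‖ ≤ _
      rw [← h₁, hg]
      exact norm_le_norm_add_of_inner_eq_zero (h _ _)
    · change ‖(y : E)‖ ≤ _
      rw [← h₂, hg, add_comm]
      exact norm_le_norm_add_of_inner_eq_zero (inner_eq_zero_comm.1 (h _ _))
  have hanti : AntilipschitzWith 1 g :=
    AddMonoidHomClass.antilipschitz_of_bound g fun z => by simpa using hbound z
  have hcl : IsClosed (g.range : Set E) :=
    hanti.isClosed_range (uniformContinuous_addMonoidHom_of_continuous g.continuous)
  have : CompleteSpace g.range := hcl.completeSpace_coe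
  have hrange : g.range = M.map e₁.toLinearMap ⊔ N.map e₂.toLinearMap := by
    ext z
    rw [Submodule.mem_sup]
    constructor
    · rintro ⟨⟨x, y⟩, rfl⟩
      exact ⟨_, ⟨x, x.2, rfl⟩, _, ⟨y, y.2, rfl⟩, rfl⟩
    · rintro ⟨_, ⟨x, hx, rfl⟩, _, ⟨y, hy, rfl⟩, rfl⟩
      exact ⟨(⟨x, hx⟩, ⟨y, hy⟩), rfl⟩
  refine ⟨g.range, ?_, hcl, ?_⟩
  · rw [hrange]
    exact (hM.map _).sup (hN.map _)
  · obtain ⟨e⟩ := nonempty_continuousLinearEquiv_of_bijective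
      (g.codRestrict g.range fun z => ⟨z, rfl⟩)
      ⟨fun a b hab => hanti.injective (congrArg Subtype.val hab),
        fun ⟨_, z, hz⟩ => ⟨z, Subtype.ext hz⟩⟩
    exact ⟨e.symm⟩

end Embedding

/-! ### Completeness of `H_A` and its coordinate isometries. -/

namespace StandardModule

variable {A : Type*} [CStarAlgebra A] [PartialOrder A] [StarOrderedRing A]

instance : IsScalarTower ℂ Aᵐᵒᵖ (StandardModule A) :=
  ⟨fun z a x => by ext i; simp⟩

theorem inner_eq (x y : StandardModule A) :
    inner Aᵐᵒᵖ x y = MulOpposite.op (∑' i, star (x.coord i) * y.coord i) := rfl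

@[simp] theorem coord_sub (x y : StandardModule A) (i : ℕ) :
    (x - y).coord i = x.coord i - y.coord i := rfl

theorem norm_sq_eq_norm_tsum (x : StandardModule A) :
    ‖x‖ ^ 2 = ‖∑' i, star (x.coord i) * x.coord i‖ := by
  rw [CStarModule.norm_sq_eq Aᵐᵒᵖ, inner_eq, MulOpposite.norm_op]

theorem norm_sum_le_norm_sq (x : StandardModule A) (s : Finset ℕ) :
    ‖∑ i ∈ s, star (x.coord i) * x.coord i‖ ≤ ‖x‖ ^ 2 := by
  rw [norm_sq_eq_norm_tsum]
  exact CStarAlgebra.norm_le_norm_of_nonneg_of_le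
    (Finset.sum_nonneg fun i _ => star_mul_self_nonneg _)
    (x.summable_self.sum_le_tsum s fun i _ => star_mul_self_nonneg _)

theorem norm_sq_le_of_forall_norm_sum_le {x : StandardModule A} {c : ℝ}
    (h : ∀ s : Finset ℕ, ‖∑ i ∈ s, star (x.coord i) * x.coord i‖ ≤ c) : ‖x‖ ^ 2 ≤ c := by
  rw [norm_sq_eq_norm_tsum]
  exact le_of_tendsto x.summable_self.hasSum.norm (Filter.Eventually.of_forall h)

theorem norm_coord_le (x : StandardModule A) (i : ℕ) : ‖x.coord i‖ ≤ ‖x‖ := by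
  have h := x.norm_sum_le_norm_sq {i}
  rw [Finset.sum_singleton, CStarRing.norm_star_mul_self, ← sq] at h
  exact (pow_le_pow_iff_left₀ (norm_nonneg _) (norm_nonneg _) two_ne_zero).1 h

instance : CompleteSpace (StandardModule A) := by
  refine Metric.complete_of_cauchySeq_tendsto fun u hu => ?_
  have hcoord : ∀ i, ∃ a, Filter.Tendsto (fun n => (u n).coord i) Filter.atTop (nhds a) := by
    intro i
    refine cauchySeq_tendsto_of_complete (Metric.cauchySeq_iff.2 fun ε hε => ?_)
    obtain ⟨N, hN⟩ := Metric.cauchySeq_iff.1 hu ε hε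
    refine ⟨N, fun m hm n hn => lt_of_le_of_lt ?_ (hN m hm n hn)⟩
    rw [dist_eq_norm, dist_eq_norm, ← coord_sub]
    exact norm_coord_le _ _
  choose a ha using hcoord
  -- The bound is uniform in the finite set `s`: it is obtained by letting `m → ∞` in the Cauchy
  -- estimate for `u n - u m`.
  have hlim : ∀ ε > 0, ∃ N, ∀ n ≥ N, ∀ s : Finset ℕ,
      ‖∑ i ∈ s, star ((u n).coord i - a i) * ((u n).coord i - a i)‖ ≤ ε ^ 2 := by
    intro ε hε
    obtain ⟨N, hN⟩ := Metric.cauchySeq_iff.1 hu ε hε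
    refine ⟨N, fun n hn s => ?_⟩
    have ht : Filter.Tendsto (fun m => ‖∑ i ∈ s, star ((u n).coord i - (u m).coord i) *
        ((u n).coord i - (u m).coord i)‖) Filter.atTop
        (nhds ‖∑ i ∈ s, star ((u n).coord i - a i) * ((u n).coord i - a i)‖) := by
      refine (tendsto_finsetSum _ fun i _ => ?_).norm
      have := (tendsto_const_nhds (x := (u n).coord i)).sub (ha i)
      exact this.star.mul this
    refine le_of_tendsto ht (Filter.eventually_atTop.2 ⟨N, fun m hm => ?_⟩)
    refine ((u n - u m).norm_sum_le_norm_sq s).trans ?_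
    have := hN n hn m hm
    rw [dist_eq_norm] at this
    gcongr
  have hsum : Summable fun i => star (a i) * a i := by
    rw [summable_iff_vanishing_norm]
    intro ε hε
    obtain ⟨N, hN⟩ := hlim (√(ε / 4)) (by positivity)
    obtain ⟨s, hs⟩ := summable_iff_vanishing_norm.1 (u N).summable_self (ε / 4) (by positivity)
    refine ⟨s, fun t hts => ?_⟩
    have h1 := hN N le_rfl t
    rw [Real.sq_sqrt (by positivity)] at h1
    have h2 := hs t hts
    -- With `u = u N`, termwise `2(u - a)^*(u - a) + 2u^*u - a^*a = (2u - a)^*(2u - a) ≥ 0`. The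
    -- factor `2` and the two summands account for `ε / 4`.
    have hle : ∑ i ∈ t, star (a i) * a i ≤
        (2 : ℝ) • (∑ i ∈ t, star ((u N).coord i - a i) * ((u N).coord i - a i)
          + ∑ i ∈ t, star ((u N).coord i) * (u N).coord i) := by
      rw [← Finset.sum_add_distrib, Finset.smul_sum]
      refine Finset.sum_le_sum fun i _ => ?_
      have h : 0 ≤ star ((2 : ℝ) • (u N).coord i - a i) * ((2 : ℝ) • (u N).coord i - a i) :=
        star_mul_self_nonneg _
      rw [← sub_nonneg]
      convert h using 1
      simp only [two_smul, star_add, star_sub]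
      noncomm_ring
    have h3 := CStarAlgebra.norm_le_norm_of_nonneg_of_le
      (Finset.sum_nonneg fun i _ => star_mul_self_nonneg _) hle
    have h4 := norm_add_le (∑ i ∈ t, star ((u N).coord i - a i) * ((u N).coord i - a i))
      (∑ i ∈ t, star ((u N).coord i) * (u N).coord i)
    rw [norm_smul, Real.norm_ofNat] at h3
    linarith
  let x : StandardModule A := ⟨a, hsum⟩
  have hx : ∀ i, x.coord i = a i := fun _ => rfl
  refine ⟨x, Metric.tendsto_atTop.2 fun ε hε => ?_⟩
  obtain ⟨N, hN⟩ := hlim (ε / 2) (by positivity)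
  refine ⟨N, fun n hn => ?_⟩
  have h : ‖u n - x‖ ^ 2 ≤ (ε / 2) ^ 2 :=
    norm_sq_le_of_forall_norm_sum_le fun s => by simpa [hx] using hN n hn s
  have h' := (pow_le_pow_iff_left₀ (norm_nonneg _) (by positivity) two_ne_zero).1 h
  rw [dist_eq_norm]
  linarith

theorem summable_extend {φ : ℕ → ℕ} (hφ : Function.Injective φ) (x : StandardModule A) :
    Summable fun i => star (Function.extend φ x.coord 0 i) * Function.extend φ x.coord 0 i := by
  refine (Function.Injective.summable_iff hφ fun i hi => ?_).1 ?_
  · rw [Function.extend_apply' _ _ _ (by simpa using hi)]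
    simp
  · refine x.summable_self.congr fun i => ?_
    simp [hφ.extend_apply]

theorem tsum_extend {φ : ℕ → ℕ} (hφ : Function.Injective φ) (x : StandardModule A) :
    ∑' i, star (Function.extend φ x.coord 0 i) * Function.extend φ x.coord 0 i =
      ∑' i, star (x.coord i) * x.coord i := by
  rw [← hφ.tsum_eq]
  · simp [hφ.extend_apply]
  · intro i hi
    by_contra h
    exact hi (by simp [Function.extend_apply' _ _ _ h])

/-- The isometry of `H_A` that places the `i`-th coordinate of a sequence in position `φ i` and
fills up with zeros. -/
noncomputable def reindex {φ : ℕ → ℕ} (hφ : Function.Injective φ) :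
    StandardModule A →L[Aᵐᵒᵖ] StandardModule A :=
  let f : StandardModule A →ₗ[Aᵐᵒᵖ] StandardModule A :=
    { toFun := fun x => ⟨Function.extend φ x.coord 0, x.summable_extend hφ⟩
      map_add' := fun x y => by
        ext i
        change Function.extend φ (x + y).coord 0 i =
          Function.extend φ x.coord 0 i + Function.extend φ y.coord 0 i
        by_cases h : ∃ j, φ j = i
        · obtain ⟨j, rfl⟩ := h
          simp [hφ.extend_apply]
        · simp [Function.extend_apply' _ _ _ h]
      map_smul' := fun a x => by
        ext i
        change Function.extend φ (a • x).coord 0 i = Function.extend φ x.coord 0 i * a.unop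
        by_cases h : ∃ j, φ j = i
        · obtain ⟨j, rfl⟩ := h
          simp [hφ.extend_apply]
        · simp [Function.extend_apply' _ _ _ h] }
  ⟨f, by
    refine AddMonoidHomClass.continuous_of_bound f 1 fun x => ?_
    rw [one_mul]
    refine norm_le_norm_of_inner_self_le Aᵐᵒᵖ (le_of_eq ?_)
    rw [inner_eq, inner_eq]
    congr 1
    exact x.tsum_extend hφ⟩

theorem coord_reindex {φ : ℕ → ℕ} (hφ : Function.Injective φ) (x : StandardModule A) (i : ℕ) :
    (reindex hφ x).coord i = Function.extend φ x.coord 0 i := rfl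

theorem norm_reindex {φ : ℕ → ℕ} (hφ : Function.Injective φ) (x : StandardModule A) :
    ‖reindex hφ x‖ = ‖x‖ := by
  rw [← sq_eq_sq₀ (norm_nonneg _) (norm_nonneg _), norm_sq_eq_norm_tsum, norm_sq_eq_norm_tsum]
  congr 1
  exact x.tsum_extend hφ

theorem inner_reindex_eq_zero {φ ψ : ℕ → ℕ} (hφ : Function.Injective φ)
    (hψ : Function.Injective ψ) (h : ∀ i j, φ i ≠ ψ j) (x y : StandardModule A) :
    inner Aᵐᵒᵖ (reindex hφ x) (reindex hψ y) = 0 := by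
  rw [inner_eq, MulOpposite.op_eq_zero_iff]
  convert tsum_zero with k
  rw [coord_reindex, coord_reindex]
  by_cases hk : ∃ i, φ i = k
  · obtain ⟨i, rfl⟩ := hk
    rw [Function.extend_apply' _ _ _ fun ⟨j, hj⟩ => h i j hj.symm]
    simp
  · rw [Function.extend_apply' _ _ _ hk]
    simp

/-- A direct sum of two finitely generated Hilbert submodules of `H_A` is isomorphic to a finitely
generated Hilbert submodule of `H_A`. -/
theorem exists_fg_isClosed_equiv_prod {M N : Submodule Aᵐᵒᵖ (StandardModule A)}
    (hM : M.FG) (hM' : IsClosed (M : Set (StandardModule A)))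
    (hN : N.FG) (hN' : IsClosed (N : Set (StandardModule A))) :
    ∃ L : Submodule Aᵐᵒᵖ (StandardModule A), L.FG ∧ IsClosed (L : Set (StandardModule A)) ∧
      Nonempty (L ≃L[Aᵐᵒᵖ] (M × N)) := by
  -- Even and odd positions carry the two orthogonal copies of `H_A`.
  have hφ : Function.Injective fun i : ℕ => 2 * i := fun i j h => by simpa using h
  have hψ : Function.Injective fun i : ℕ => 2 * i + 1 := fun i j h => by simpa using h
  exact _root_.exists_fg_isClosed_equiv_prod (norm_reindex hφ) (norm_reindex hψ)
    (inner_reindex_eq_zero hφ hψ fun i j => by lia) hM hM' hN hN'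

end StandardModule

/-! ### Finitely generated corrections to kernel and cokernel. -/

section FiniteRank

variable {B : Type*} [CStarAlgebra B] [PartialOrder B] [StarOrderedRing B]
variable {E : Type*} [NormedAddCommGroup E] [NormedSpace ℂ E] [Module B E] [CStarModule B E]

theorem IsOrthComplemented.ker_proj {K : Submodule B E} (hK : IsOrthComplemented K) :
    hK.proj.ker = _root_.orthCompl K := by
  ext x
  refine ⟨fun hx => ?_, fun hx => hK.proj_eq_zero hx⟩
  have hx : hK.proj x = 0 := hx
  have h := hK.sub_proj_mem x
  rwa [hx, sub_zero] at h

theorem IsOrthComplemented.range_comp_proj {K : Submodule B E} (hK : IsOrthComplemented K)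
    (T : E →L[B] E) : (T.comp hK.proj).range = K.map T.toLinearMap := by
  conv_rhs => rw [← hK.range_proj]
  exact LinearMap.range_comp _ _

variable [IsScalarTower ℂ B E] [CompleteSpace E]

/-- The source of all finite generation below: `(ker F)^⊥ = F*(Im F)`. -/
theorem fg_orthCompl_ker {F : E →L[B] E} (hF : IsAdjointable F)
    (hcl : IsClosed (F.range : Set E)) (hfg : F.range.FG) : (orthCompl F.ker).FG := by
  obtain ⟨S, hS⟩ := hF
  rw [orthCompl_ker_eq_map_adjoint hS hcl]
  exact hfg.map _

/-- If `F` has finitely generated range, then the kernel of `T` is the sum of `ker T ⊓ ker F` and a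
finitely generated module. -/
theorem exists_ker_equiv_inf_ker_prod {T F : E →L[B] E} (hT : IsAdjointable T)
    (hT_closed : IsClosed (T.range : Set E)) (hF : IsAdjointable F)
    (hF_closed : IsClosed (F.range : Set E)) (hF_fg : F.range.FG)
    (h_proj : IsClosed (orthProj (orthCompl F.ker) '' (T.ker : Set E))) :
    ∃ L : Submodule B E, L.FG ∧ IsClosed (L : Set E) ∧
      Nonempty (T.ker ≃L[B] ((T.ker ⊓ F.ker : Submodule B E) × L)) := by
  have hK : IsOrthComplemented F.ker := isOrthComplemented_ker hF hF_closed
  have hQ : IsOrthComplemented T.ker := isOrthComplemented_ker hT hT_closed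
  have hP_ker : hK.orthCompl.proj.ker = F.ker := by
    rw [hK.orthCompl.ker_proj, hK.orthCompl_orthCompl]
  have hV_range : (hK.orthCompl.proj.comp hQ.proj).range =
      T.ker.map hK.orthCompl.proj.toLinearMap := hQ.range_comp_proj _
  have hL_closed : IsClosed (T.ker.map hK.orthCompl.proj.toLinearMap : Set E) := h_proj
  have hV_adj : IsAdjointable (hK.orthCompl.proj.comp hQ.proj) :=
    hK.orthCompl.isAdjointable_proj.comp hQ.isAdjointable_proj
  have hV_closed : IsClosed ((hK.orthCompl.proj.comp hQ.proj).range : Set E) := by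
    rwa [hV_range]
  have hV := isOrthComplemented_ker hV_adj hV_closed
  have hL := isOrthComplemented_range hV_adj hV_closed
  -- The projection `p` onto `ker(PQ)`, with `Q` the projection onto `ker T`, must preserve `ker T`
  -- to serve in the splitting. It does, since `x - p x ∈ ker(PQ)^⊥ ⊆ ker T`.
  have hVT : orthCompl (hK.orthCompl.proj.comp hQ.proj).ker ≤ T.ker := by
    conv_rhs => rw [← hQ.orthCompl_orthCompl]
    refine orthCompl_anti fun x hx => ?_
    change hK.orthCompl.proj (hQ.proj x) = 0
    rw [hQ.proj_eq_zero hx, map_zero]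
  refine ⟨T.ker.map hK.orthCompl.proj.toLinearMap, ?_, hL_closed, ?_⟩
  · rw [hV_range] at hL
    -- A submodule of a finitely generated module need not be finitely generated; a complemented one
    -- is, being its image under the projection.
    have hLM : T.ker.map hK.orthCompl.proj.toLinearMap =
        (orthCompl F.ker).map hL.proj.toLinearMap := by
      apply le_antisymm
      · rintro _ ⟨x, hx, rfl⟩
        exact ⟨_, hK.orthCompl.proj_mem x, hL.proj_eq_self ⟨x, hx, rfl⟩⟩
      · rintro _ ⟨x, -, rfl⟩
        exact hL.proj_mem x
    rw [hLM]
    exact (fg_orthCompl_ker hF hF_closed hF_fg).map _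
  · have h := nonempty_equiv_inf_ker_prod_map T.isClosed_ker hK.orthCompl.proj hL_closed hV.proj
      (fun x hx => ?_) fun x hx => hV.proj_eq_self ?_
    · rwa [hP_ker] at h
    · have h1 : hV.proj x ∈ T.ker := by
        have := T.ker.sub_mem hx (hVT (hV.sub_proj_mem x))
        rwa [sub_sub_cancel] at this
      refine ⟨h1, ?_⟩
      have h2 : hK.orthCompl.proj (hQ.proj (hV.proj x)) = 0 := hV.proj_mem x
      rwa [hQ.proj_eq_self h1] at h2
    · change hK.orthCompl.proj (hQ.proj x) = 0
      rw [hQ.proj_eq_self hx.1]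
      exact hx.2

/-- If `F` has finitely generated range, then the orthogonal complement of `T(ker F)` is the sum of
the orthogonal complement of `Im T` and a finitely generated module. -/
theorem exists_orthCompl_map_ker_equiv_orthCompl_range_prod {T F : E →L[B] E}
    (hT : IsAdjointable T) (hT_closed : IsClosed (T.range : Set E)) (hF : IsAdjointable F)
    (hF_closed : IsClosed (F.range : Set E)) (hF_fg : F.range.FG)
    (h_image : IsClosed (T '' (F.ker : Set E))) :
    ∃ R : Submodule B E, R.FG ∧ IsClosed (R : Set E) ∧
      Nonempty (orthCompl (F.ker.map T.toLinearMap) ≃L[B] (orthCompl T.range × R)) := by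
  have hK : IsOrthComplemented F.ker := isOrthComplemented_ker hF hF_closed
  have hR : IsOrthComplemented T.range := isOrthComplemented_range hT hT_closed
  have hTK : IsOrthComplemented (F.ker.map T.toLinearMap) := by
    rw [← hK.range_comp_proj T]
    refine isOrthComplemented_range (hT.comp hK.isAdjointable_proj) ?_
    rw [hK.range_comp_proj T]
    exact h_image
  have hTK_le : F.ker.map T.toLinearMap ≤ T.range := LinearMap.map_le_range
  have hle : orthCompl T.range ≤ orthCompl (F.ker.map T.toLinearMap) := orthCompl_anti hTK_le
  have hproj_mem : ∀ x ∈ orthCompl (F.ker.map T.toLinearMap),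
      hR.proj x ∈ orthCompl (F.ker.map T.toLinearMap) := fun x hx => by
    have := Submodule.sub_mem _ hx (hle (hR.sub_proj_mem x))
    rwa [sub_sub_cancel] at this
  have hinf : orthCompl (F.ker.map T.toLinearMap) ⊓ hR.proj.ker = orthCompl T.range := by
    rw [hR.ker_proj, inf_eq_right]
    exact hle
  have hmap : (orthCompl (F.ker.map T.toLinearMap)).map hR.proj.toLinearMap =
      orthCompl (F.ker.map T.toLinearMap) ⊓ T.range := by
    apply le_antisymm
    · rintro _ ⟨x, hx, rfl⟩
      exact ⟨hproj_mem x hx, hR.proj_mem x⟩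
    · rintro x ⟨hx, hx'⟩
      exact ⟨x, hx, hR.proj_eq_self hx'⟩
  -- A vector `T x` in `W = T(ker F)^⊥` is its own projection to `W`, and this projection kills the
  -- part of `T x` coming from `ker F`. Conversely, projecting `T x` to `W` subtracts an element of
  -- `T(ker F)`, so the result stays in `Im T`.
  have hmap' : (orthCompl (F.ker.map T.toLinearMap)).map hR.proj.toLinearMap =
      (orthCompl F.ker).map (hTK.orthCompl.proj.comp T).toLinearMap := by
    rw [hmap]
    apply le_antisymm
    · rintro _ ⟨hx, ⟨x, rfl⟩⟩
      refine ⟨x - hK.proj x, hK.sub_proj_mem x, ?_⟩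
      have h0 : hTK.orthCompl.proj (T (hK.proj x)) = 0 := by
        refine hTK.orthCompl.proj_eq_zero ?_
        rw [hTK.orthCompl_orthCompl]
        exact ⟨_, hK.proj_mem x, rfl⟩
      have h1 : hTK.orthCompl.proj (T x) = T x := hTK.orthCompl.proj_eq_self hx
      simp [h0, h1]
    · rintro _ ⟨x, -, rfl⟩
      refine ⟨hTK.orthCompl.proj_mem _, ?_⟩
      have h := hTK.orthCompl.sub_proj_mem (T x)
      rw [hTK.orthCompl_orthCompl] at h
      have := T.range.sub_mem ⟨x, rfl⟩ (hTK_le h)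
      simpa using this
  have hcl : IsClosed ((orthCompl (F.ker.map T.toLinearMap)).map hR.proj.toLinearMap : Set E) := by
    rw [hmap]
    exact (isClosed_orthCompl _).inter hT_closed
  refine ⟨_, ?_, hcl, ?_⟩
  · rw [hmap']
    exact (fg_orthCompl_ker hF hF_closed hF_fg).map _
  · have := nonempty_equiv_inf_ker_prod_map (isClosed_orthCompl (F.ker.map T.toLinearMap)) hR.proj
      hcl hR.orthCompl.proj (fun x hx => by rw [hinf]; exact hR.orthCompl.proj_mem x)
      (fun x hx => by rw [hinf] at hx; exact hR.orthCompl.proj_eq_self hx)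
    rwa [hinf] at this

end FiniteRank

/-! ### Assembling the isomorphism for `T + F`. -/

/-- An isomorphism `N × K ≃ N' × C` carries over to `K'` and `C'`, after enlarging `N` and `N'`, if
`K` and `K'` have a common summand `Z` and `C` and `C'` are summands of the same module `W`. -/
theorem nonempty_equiv_prod_of_equiv_prod {B : Type*} [Ring B]
    {N N' K K' C C' Z W L L' R R' : Type*}
    [AddCommGroup N] [Module B N] [TopologicalSpace N]
    [AddCommGroup N'] [Module B N'] [TopologicalSpace N']
    [AddCommGroup K] [Module B K] [TopologicalSpace K]
    [AddCommGroup K'] [Module B K'] [TopologicalSpace K']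
    [AddCommGroup C] [Module B C] [TopologicalSpace C]
    [AddCommGroup C'] [Module B C'] [TopologicalSpace C']
    [AddCommGroup Z] [Module B Z] [TopologicalSpace Z]
    [AddCommGroup W] [Module B W] [TopologicalSpace W]
    [AddCommGroup L] [Module B L] [TopologicalSpace L]
    [AddCommGroup L'] [Module B L'] [TopologicalSpace L']
    [AddCommGroup R] [Module B R] [TopologicalSpace R]
    [AddCommGroup R'] [Module B R'] [TopologicalSpace R']
    (e : (N × K) ≃L[B] (N' × C)) (eK : K ≃L[B] (Z × L)) (eK' : K' ≃L[B] (Z × L'))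
    (eC : W ≃L[B] (C × R)) (eC' : W ≃L[B] (C' × R')) :
    Nonempty (((N × (L × R)) × K') ≃L[B] ((N' × (L' × R')) × C')) := by
  -- Expose `Z × L` to rebuild `K`, setting `R` and `L'` aside; after `e`, the spare `R` joins `C`
  -- to form `W`, which is split again as `C' × R'`.
  let a : ((N × (L × R)) × K') ≃L[B] ((N × (Z × L)) × (R × L')) :=
    { toFun := fun x => ((x.1.1, ((eK' x.2).1, x.1.2.1)), (x.1.2.2, (eK' x.2).2))
      invFun := fun y => ((y.1.1, (y.1.2.2, y.2.1)), eK'.symm (y.1.2.1, y.2.2))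
      map_add' := fun x y => by simp
      map_smul' := fun b x => by simp
      left_inv := fun x => by simp
      right_inv := fun y => by simp
      continuous_toFun := by fun_prop
      continuous_invFun := by fun_prop }
  let b : ((N × (Z × L)) × (R × L')) ≃L[B] ((N' × C) × (R × L')) :=
    (((ContinuousLinearEquiv.refl B N).prodCongr eK.symm).trans e).prodCongr
      (ContinuousLinearEquiv.refl B _)
  let c : ((N' × C) × (R × L')) ≃L[B] ((N' × L') × (C × R)) :=
    { toFun := fun x => ((x.1.1, x.2.2), (x.1.2, x.2.1))
      invFun := fun y => ((y.1.1, y.2.1), (y.2.2, y.1.2))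
      map_add' := fun x y => by simp
      map_smul' := fun b x => by simp
      left_inv := fun x => by simp
      right_inv := fun y => by simp
      continuous_toFun := by fun_prop
      continuous_invFun := by fun_prop }
  let d : ((N' × L') × (C × R)) ≃L[B] ((N' × L') × (C' × R')) :=
    (ContinuousLinearEquiv.refl B _).prodCongr (eC.symm.trans eC')
  let f : ((N' × L') × (C' × R')) ≃L[B] ((N' × (L' × R')) × C') :=
    { toFun := fun x => ((x.1.1, (x.1.2, x.2.2)), x.2.1)
      invFun := fun y => ((y.1.1, y.1.2.1), (y.2, y.1.2.2))
      map_add' := fun x y => by simp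
      map_smul' := fun b x => by simp
      left_inv := fun x => by simp
      right_inv := fun y => by simp
      continuous_toFun := by fun_prop
      continuous_invFun := by fun_prop }
  exact ⟨(((a.trans b).trans c).trans d).trans f⟩

theorem mainTheorem1 {A : Type*} [CStarAlgebra A] [PartialOrder A] [StarOrderedRing A]
    (T F : StandardModule A →L[Aᵐᵒᵖ] StandardModule A)
    (hT : IsGenWeylStable T)
    (hF : IsAdjointable F)
    (hF_closed : IsClosed (F.range : Set (StandardModule A)))
    (hF_fg : F.range.FG)
    (h_range : IsClosed ((T + F).range : Set (StandardModule A)))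
    (h_image : IsClosed (T '' (F.ker : Set (StandardModule A))))
    (h_proj : IsClosed (orthProj (orthCompl F.ker) '' (T.ker : Set (StandardModule A))))
    (h_proj_add : IsClosed
      (orthProj (orthCompl F.ker) '' ((T + F).ker : Set (StandardModule A)))) :
    IsGenWeylStable (T + F) := by
  obtain ⟨hT_adj, hT_closed, N, N', hN, hN_closed, hN', hN'_closed, ⟨e⟩⟩ := hT
  have hTF_adj : IsAdjointable (T + F) := hT_adj.add hF
  have heq : ∀ x ∈ F.ker, (T + F) x = T x := fun x hx => by
    have hx : F x = 0 := hx
    simp [hx]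
  have h_image_add : IsClosed ((T + F) '' (F.ker : Set (StandardModule A))) := by
    rwa [Set.image_congr heq]
  have hmap : F.ker.map (T + F).toLinearMap = F.ker.map T.toLinearMap :=
    SetLike.coe_injective (Set.image_congr heq)
  have hinf : (T + F).ker ⊓ F.ker = T.ker ⊓ F.ker := by
    ext x
    refine and_congr_left fun hx => ?_
    change (T + F) x = 0 ↔ T x = 0
    rw [heq x hx]
  obtain ⟨L, hL, hL_closed, ⟨eK⟩⟩ :=
    exists_ker_equiv_inf_ker_prod hT_adj hT_closed hF hF_closed hF_fg h_proj
  obtain ⟨L', hL', hL'_closed, hK'⟩ :=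
    exists_ker_equiv_inf_ker_prod hTF_adj h_range hF hF_closed hF_fg h_proj_add
  obtain ⟨R, hR, hR_closed, ⟨eC⟩⟩ := exists_orthCompl_map_ker_equiv_orthCompl_range_prod
    hT_adj hT_closed hF hF_closed hF_fg h_image
  obtain ⟨R', hR', hR'_closed, hC'⟩ := exists_orthCompl_map_ker_equiv_orthCompl_range_prod
    hTF_adj h_range hF hF_closed hF_fg h_image_add
  rw [hinf] at hK'
  rw [hmap] at hC'
  obtain ⟨eK'⟩ := hK'
  obtain ⟨eC'⟩ := hC'
  -- The external sums `N × (L × R)` and `N' × (L' × R')` are replaced by submodules of `H_A`, as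
  -- the class requires.
  obtain ⟨LR, hLR, hLR_closed, ⟨i₁⟩⟩ :=
    StandardModule.exists_fg_isClosed_equiv_prod hL hL_closed hR hR_closed
  obtain ⟨M, hM, hM_closed, ⟨i₂⟩⟩ :=
    StandardModule.exists_fg_isClosed_equiv_prod hN hN_closed hLR hLR_closed
  obtain ⟨LR', hLR', hLR'_closed, ⟨j₁⟩⟩ :=
    StandardModule.exists_fg_isClosed_equiv_prod hL' hL'_closed hR' hR'_closed
  obtain ⟨M', hM', hM'_closed, ⟨j₂⟩⟩ :=
    StandardModule.exists_fg_isClosed_equiv_prod hN' hN'_closed hLR' hLR'_closed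
  obtain ⟨E⟩ := nonempty_equiv_prod_of_equiv_prod e eK eK' eC eC'
  let i := i₂.trans ((ContinuousLinearEquiv.refl _ N).prodCongr i₁)
  let j := j₂.trans ((ContinuousLinearEquiv.refl _ N').prodCongr j₁)
  exact ⟨hTF_adj, h_range, M, M', hM, hM_closed, hM', hM'_closed,
    ⟨((i.prodCongr (ContinuousLinearEquiv.refl _ _)).trans E).trans
      (j.symm.prodCongr (ContinuousLinearEquiv.refl _ _))⟩⟩
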